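/- Let $0 \le k \le n$ be integers and let $$\mathrm{Gr}(k,n) = \{Q \in \mathbb{R}^{n\times n} : Q^{\mathsf T} = Q,\ Q^2 = I,\ \operatorname{tr}(Q) = 2k-n\},$$ a submanifold of the space of symmetric $n\times n$ matrices with the trace inner product $\langle X, Y\rangle = \operatorname{tr}(X^{\mathsf T}Y)$, equipped with the induced Riemannian metric. Let $\nabla$ be its Levi-Civita connection, $(\nabla_{v} w)(Q) = \operatorname{proj}_{T_Q \mathrm{Gr}(k,n)}(\partial_{v(Q)} w)$ for smooth vector fields $v, w$ on $\mathrm{Gr}(k,n)$, and let its Riemann curvature tensor at $Q$ be $$\mathrm{Rie}_Q(X,Y,Z,W) = \langle \nabla_X\nabla_Y Z - \nabla_Y\nabla_X Z - \nabla_{[X,Y]}Z,\ W\rangle, \qquad X,Y,Z,W \in T_Q\mathrm{Gr}(k,n),$$ where on the right $X, Y, Z$ are extended to smooth vector fields on $\mathrm{Gr}(k,n)$; such extensions exist, and the value at $Q$ does not depend on their choice. Then for every $Q \in \mathrm{Gr}(k,n)$ and all $X,Y,Z,W \in T_Q\mathrm{Gr}(k,n)$, $$\mathrm{Rie}_Q(X,Y,Z,W)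 = \tfrac12 \operatorname{tr}\bigl((XY-YX)ZW\bigr).$$ Moreover, if $V \in \mathrm{O}(n)$ is such that $Q = V\begin{bmatrix} I_k & 0\\ 0 & -I_{n-k}\end{bmatrix}V^{\mathsf T}$, and $X = V\begin{bmatrix} 0 & X_0\\ X_0^{\mathsf T} & 0\end{bmatrix}V^{\mathsf T}$ with $X_0 \in \mathbb{R}^{k\times(n-k)}$, and $Y, Z, W$ are given in the same way by $Y_0, Z_0, W_0 \in \mathbb{R}^{k\times(n-k)}$, then $X, Y, Z, W \in T_Q\mathrm{Gr}(k,n)$ and $$\mathrm{Rie}_Q(X,Y,Z,W) = \tfrac12 \operatorname{tr}\bigl((X_0^{\mathsf T}Y_0Z_0^{\mathsf T} + Z_0^{\mathsf T}Y_0X_0^{\mathsf T} - Y_0^{\mathsf T}X_0Z_0^{\mathsf T} - Z_0^{\mathsf T}X_0Y_0^{\mathsf T})W_0\bigr).$$ -/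

import Mathlib

open scoped Matrix ContDiff

/-! ### Submanifolds of a Euclidean space

`M` is an embedded submanifold of a Euclidean space `E`, given as a subset.  Tangent vectors are
vectors of `E`, vector fields on `M` are maps to `E` of which only the values on `M` matter. -/

namespace EmbeddedManifold

section General

variable {E : Type*} [NormedAddCommGroup E] [InnerProductSpace ℝ E] [FiniteDimensional ℝ E]

/-- The tangent space of `M` at `x`, i.e. the linear space of the velocities at time `0` of the smooth
curves in `M` that pass through `x` at time `0`.  (On a submanifold these velocities already form a
linear subspace, so that taking the span adds nothing.) -/
def tangentSpace (M : Set E) (x : E) : Submodule ℝ E :=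
  Submodule.span ℝ {v | ∃ γ : ℝ → E, ContDiff ℝ ∞ γ ∧ (∀ t, γ t ∈ M) ∧ γ 0 = x ∧ HasDerivAt γ v 0}

/-- `w` restricts to a smooth vector field on `M`. -/
def IsSmoothVectorField (M : Set E) (w : E → E) : Prop :=
  ContDiffOn ℝ ∞ w M ∧ ∀ x ∈ M, w x ∈ tangentSpace M x

/-- The Levi-Civita connection of the metric that `M` inherits from `E`:
`(∇_v w)(x) = proj_{T_x M} (∂_{v(x)} w)`, where `∂_{v(x)} w` is the directional derivative along `M`.
(A derivative of `w` within `M` at `x` is uniquely determined on the tangent space of `M` at `x`, which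
contains `v x`, even where it is not unique as a linear map on all of `E`.) -/
noncomputable def leviCivita (M : Set E) (v w : E → E) : E → E := fun x =>
  (tangentSpace M x).starProjection (fderivWithin ℝ w M x (v x))

/-- The curvature `R(u, v) w = ∇_u ∇_v w - ∇_v ∇_u w - ∇_{[u, v]} w` of vector fields on `M`.  The Lie
bracket is `[u, v](x) = ∂_{u(x)} v - ∂_{v(x)} u`, with derivatives along `M`. -/
noncomputable def curvature (M : Set E) (u v w : E → E) : E → E := fun x =>
  leviCivita M u (leviCivita M v w) x - leviCivita M v (leviCivita M u w) x
    - leviCivita M (VectorField.lieBracketWithin ℝ u v M) w x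

/-- `HasRiemannCurvature M x u v w z r` says that the Riemann curvature tensor of `M` at `x ∈ M` has
the value `Rie_x(u, v, w, z) = r` at the tangent vectors `u`, `v`, `w`, `z`: there are smooth vector
fields on `M` that extend `u`, `v`, `w`, and for every choice of such vector fields the value
at `x` of `R(u, v) w` has inner product `r` with `z`. -/
def HasRiemannCurvature (M : Set E) (x u v w z : E) (r : ℝ) : Prop :=
  x ∈ M ∧ z ∈ tangentSpace M x ∧
  (∀ a ∈ ({u, v, w} : Set E), ∃ A : E → E, IsSmoothVectorField M A ∧ A x = a) ∧
  ∀ U V W : E → E, IsSmoothVectorField M U → IsSmoothVectorField M V → IsSmoothVectorField M W →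
    U x = u → V x = v → W x = w → inner ℝ (curvature M U V W x) z = r

/-- The value of the Riemann curvature tensor is unique. -/
theorem HasRiemannCurvature.unique {M : Set E} {x u v w z : E} {r s : ℝ}
    (hr : HasRiemannCurvature M x u v w z r) (hs : HasRiemannCurvature M x u v w z s) : r = s := by
  obtain ⟨U, hU, hUx⟩ := hr.2.2.1 u (by simp)
  obtain ⟨V, hV, hVx⟩ := hr.2.2.1 v (by simp)
  obtain ⟨W, hW, hWx⟩ := hr.2.2.1 w (by simp)
  rw [← hr.2.2.2 U V W hU hV hW hUx hVx hWx, ← hs.2.2.2 U V W hU hV hW hUx hVx hWx]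

end General

end EmbeddedManifold

/-! ### The space of matrices with the trace inner product -/

attribute [local instance] Matrix.frobeniusNormedAddCommGroup Matrix.frobeniusNormedSpace

/-- The trace inner product `⟨X, Y⟩ = tr(Xᵀ Y)` on `n × n` real matrices; its norm is the
Frobenius norm. -/
noncomputable local instance matrixTraceInner (n : ℕ) :
    InnerProductSpace ℝ (Matrix (Fin n) (Fin n) ℝ) where
  inner X Y := (Xᵀ * Y).trace
  norm_sq_eq_re_inner X := by
    have h : (0 : ℝ) ≤ ∑ i, ∑ j, X i j ^ 2 :=
      Finset.sum_nonneg fun i _ => Finset.sum_nonneg fun j _ => sq_nonneg _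
    rw [Matrix.frobenius_norm_def]
    simp only [Real.norm_eq_abs, Real.rpow_ofNat, sq_abs, RCLike.re_to_real]
    rw [← Real.sqrt_eq_rpow, Real.sq_sqrt h, Finset.sum_comm]
    simp [Matrix.trace, Matrix.mul_apply, sq]
  conj_inner_symm X Y := by
    simp only [conj_trivial]
    rw [← Matrix.trace_transpose, Matrix.transpose_mul, Matrix.transpose_transpose]
  add_left X Y Z := by simp [add_mul]
  smul_left X Y r := by simp

/-! ### The Grassmannian in the involution model -/

namespace Involution

/-- `Gr(k, n)`, the set of symmetric `n × n` matrices `Q` with `Q² = I` and `tr(Q) = 2k - n`. -/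
def Gr (k n : ℕ) : Set (Matrix (Fin n) (Fin n) ℝ) :=
  {Q | Qᵀ = Q ∧ Q * Q = 1 ∧ Q.trace = 2 * (k : ℝ) - (n : ℝ)}

/-- The `n × n` matrix with blocks `A` (`k × k`), `B`, `C`, `D` (`(n-k) × (n-k)`), for `k ≤ n`. -/
def blocks {k n : ℕ} (hkn : k ≤ n) (A : Matrix (Fin k) (Fin k) ℝ)
    (B : Matrix (Fin k) (Fin (n - k)) ℝ) (C : Matrix (Fin (n - k)) (Fin k) ℝ)
    (D : Matrix (Fin (n - k)) (Fin (n - k)) ℝ) : Matrix (Fin n) (Fin n) ℝ :=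
  let e : Fin k ⊕ Fin (n - k) ≃ Fin n :=
    finSumFinEquiv.trans (finCongr (Nat.add_sub_of_le hkn))
  Matrix.reindex e e (Matrix.fromBlocks A B C D)

/-- The matrix `V [0, X₀; X₀ᵀ, 0] Vᵀ`. -/
def tangentMatrix {k n : ℕ} (hkn : k ≤ n) (V : Matrix (Fin n) (Fin n) ℝ)
    (X₀ : Matrix (Fin k) (Fin (n - k)) ℝ) : Matrix (Fin n) (Fin n) ℝ :=
  V * blocks hkn 0 X₀ X₀ᵀ 0 * Vᵀ

end Involution

/-! Near a point of `M`, composing with a smooth retraction `r` onto `M` extends a field `w` on `M`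
to the smooth field `w ∘ r`, so derivatives along `M` become ordinary ones. Let `P` be the field of
tangent projections. When `R(u, v) w` is expanded, the second derivatives of `w` cancel by symmetry,
the terms containing derivatives of `u` and `v` cancel against the bracket term, and what remains is
`P (dP(u) (dw(v))) - P (dP(v) (dw(u)))` (`curvature_eq`).

On the Grassmannian, tangent vectors at `Q` are the symmetric matrices anticommuting with `Q`, and
`P` sends a symmetric `S` to `(S - QSQ) / 2`. The matrix `P (dP(U) S)` depends on `S` only through
`SQ + QS`. For `S = dw(v)`, differentiating `wQ + Qw = 0` gives `SQ + QS = -(wv + vw)`, so all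
derivatives of the fields disappear. Antisymmetrizing yields `R(u, v) w = [[u, v], w] / 4`
(`curvature_eq_commutator`); pairing with a tangent vector and using the trace gives the first
formula, and block multiplication the second. -/

namespace EmbeddedManifold

/-! ### Curvature of an embedded submanifold through tangent projections -/

section Retraction

variable {E : Type*} [NormedAddCommGroup E] [InnerProductSpace ℝ E]

/-- Two derivatives of a map within `M` agree on the tangent space. -/
theorem hasFDerivWithinAt_eq_on_tangentSpace {M : Set E} {x v : E} {g : E → E}
    {g₁ g₂ : E →L[ℝ] E} (h₁ : HasFDerivWithinAt g g₁ M x) (h₂ : HasFDerivWithinAt g g₂ M x)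
    (hv : v ∈ tangentSpace M x) : g₁ v = g₂ v := by
  induction hv using Submodule.span_induction with
  | mem v hv =>
    obtain ⟨γ, -, hγM, rfl, hγ⟩ := hv
    exact (h₁.comp_hasDerivAt (0 : ℝ) hγ (.of_forall hγM)).unique
      (h₂.comp_hasDerivAt (0 : ℝ) hγ (.of_forall hγM))
  | zero => simp
  | add a b _ _ ha hb => simp [ha, hb]
  | smul c a _ ha => simp [ha]

theorem fderivWithin_apply_eq {M : Set E} {x v : E} {f g : E → E} (hx : x ∈ M)
    (hg : DifferentiableAt ℝ g x) (hfg : f =ᶠ[nhdsWithin x M] g) (hv : v ∈ tangentSpace M x) :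
    fderivWithin ℝ f M x v = fderiv ℝ g x v := by
  rw [hfg.fderivWithin_eq (hfg.eq_of_nhdsWithin hx)]
  exact hasFDerivWithinAt_eq_on_tangentSpace hg.differentiableWithinAt.hasFDerivWithinAt
    hg.hasFDerivAt.hasFDerivWithinAt hv

/-- `r` is a smooth retraction of the open set `O` onto `M ∩ O`. -/
structure IsSmoothRetraction (M O : Set E) (r : E → E) : Prop where
  isOpen : IsOpen O
  contDiffOn : ContDiffOn ℝ ∞ r O
  mapsTo : Set.MapsTo r O M
  eq_self : ∀ x ∈ O, x ∈ M → r x = x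

theorem IsSmoothRetraction.contDiffOn_comp {M O : Set E} {r w : E → E}
    (hr : IsSmoothRetraction M O r) (hw : ContDiffOn ℝ ∞ w M) : ContDiffOn ℝ ∞ (w ∘ r) O :=
  hw.comp hr.contDiffOn hr.mapsTo

theorem IsSmoothRetraction.eventuallyEq {M O : Set E} {r : E → E} {x : E}
    (hr : IsSmoothRetraction M O r) (hx : x ∈ O) (w : E → E) :
    w =ᶠ[nhdsWithin x M] w ∘ r := by
  filter_upwards [self_mem_nhdsWithin, mem_nhdsWithin_of_mem_nhds (hr.isOpen.mem_nhds hx)]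
    with y hyM hyO
  simp [hr.eq_self y hyO hyM]

theorem IsSmoothRetraction.fderivWithin_eq {M O : Set E} {r w : E → E} {x v : E}
    (hr : IsSmoothRetraction M O r) (hw : ContDiffOn ℝ ∞ w M) (hxO : x ∈ O) (hxM : x ∈ M)
    (hv : v ∈ tangentSpace M x) : fderivWithin ℝ w M x v = fderiv ℝ (w ∘ r) x v :=
  fderivWithin_apply_eq hxM
    (((hr.contDiffOn_comp hw).contDiffAt (hr.isOpen.mem_nhds hxO)).differentiableAt (by simp))
    (hr.eventuallyEq hxO w) hv

variable [FiniteDimensional ℝ E]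

/-- The iterated covariant derivative, in terms of smooth extensions `w ∘ r`, `v ∘ r` and a smooth
extension `P` of the field of orthogonal projections to the tangent spaces. -/
theorem leviCivita_leviCivita {M O : Set E} {r u v w : E → E} {x : E} {P : E → E →L[ℝ] E}
    (hr : IsSmoothRetraction M O r) (hxO : x ∈ O) (hxM : x ∈ M)
    (hP : ContDiff ℝ ∞ P) (hPM : ∀ y ∈ M, (tangentSpace M y).starProjection = P y)
    (hu : IsSmoothVectorField M u) (hv : IsSmoothVectorField M v)
    (hw : IsSmoothVectorField M w) :
    leviCivita M u (leviCivita M v w) x =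
      P x (P x (fderiv ℝ (fderiv ℝ (w ∘ r)) x (u x) (v x)
          + fderiv ℝ (w ∘ r) x (fderiv ℝ (v ∘ r) x (u x)))
        + fderiv ℝ P x (u x) (fderivWithin ℝ w M x (v x))) := by
  have hO := hr.isOpen.mem_nhds hxO
  have hw' : ContDiffAt ℝ ∞ (w ∘ r) x := (hr.contDiffOn_comp hw.1).contDiffAt hO
  have hv' : ContDiffAt ℝ ∞ (v ∘ r) x := (hr.contDiffOn_comp hv.1).contDiffAt hO
  have hdw : HasFDerivAt (fderiv ℝ (w ∘ r)) (fderiv ℝ (fderiv ℝ (w ∘ r)) x) x :=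
    ((hw'.fderiv_right (m := 1) (by
      rw [one_add_one_eq_two]; exact WithTop.coe_le_coe.mpr le_top)).differentiableAt (by simp)).hasFDerivAt
  have hdv : HasFDerivAt (v ∘ r) (fderiv ℝ (v ∘ r) x) x :=
    (hv'.differentiableAt (by simp)).hasFDerivAt
  have hdP : HasFDerivAt P (fderiv ℝ P x) x :=
    (hP.contDiffAt.differentiableAt (by simp)).hasFDerivAt
  have hG := hdP.clm_apply (hdw.clm_apply hdv)
  -- On `M` near `x`, `∇_v w` agrees with a map differentiable at `x` in the ambient space, so the
  -- outer derivative obeys the ordinary product rule.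
  have heq : leviCivita M v w =ᶠ[nhdsWithin x M]
      fun y => P y (fderiv ℝ (w ∘ r) y ((v ∘ r) y)) := by
    filter_upwards [self_mem_nhdsWithin, mem_nhdsWithin_of_mem_nhds hO] with y hyM hyO
    rw [leviCivita, hPM y hyM, Function.comp_apply, hr.eq_self y hyO hyM]
    rw [hr.fderivWithin_eq hw.1 hyO hyM (hv.2 y hyM)]
  rw [leviCivita, hPM x hxM, fderivWithin_apply_eq hxM hG.differentiableAt heq (hu.2 x hxM),
    hG.fderiv, hr.fderivWithin_eq hw.1 hxO hxM (hv.2 x hxM)]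
  simp [hr.eq_self x hxO hxM, add_comm]

/-- The curvature of an embedded submanifold in terms of the derivative of the field of orthogonal
projections to its tangent spaces. -/
theorem curvature_eq {M O : Set E} {r u v w : E → E} {x : E} {P : E → E →L[ℝ] E}
    (hr : IsSmoothRetraction M O r) (hxO : x ∈ O) (hxM : x ∈ M)
    (hP : ContDiff ℝ ∞ P) (hPM : ∀ y ∈ M, (tangentSpace M y).starProjection = P y)
    (hu : IsSmoothVectorField M u) (hv : IsSmoothVectorField M v)
    (hw : IsSmoothVectorField M w)
    (huv : VectorField.lieBracketWithin ℝ u v M x ∈ tangentSpace M x) :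
    curvature M u v w x =
      P x (fderiv ℝ P x (u x) (fderivWithin ℝ w M x (v x)))
        - P x (fderiv ℝ P x (v x) (fderivWithin ℝ w M x (u x))) := by
  have hw' : ContDiffAt ℝ ∞ (w ∘ r) x :=
    (hr.contDiffOn_comp hw.1).contDiffAt (hr.isOpen.mem_nhds hxO)
  have hsymm : fderiv ℝ (fderiv ℝ (w ∘ r)) x (u x) (v x)
      = fderiv ℝ (fderiv ℝ (w ∘ r)) x (v x) (u x) :=
    (hw'.isSymmSndFDerivAt (by rw [minSmoothness_of_isRCLikeNormedField]; exact WithTop.coe_le_coe.mpr le_top)).eq _ _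
  have hPP : ∀ a, P x (P x a) = P x a := fun a => by
    rw [← hPM x hxM]
    exact Submodule.starProjection_eq_self_iff.mpr (Submodule.starProjection_apply_mem _ a)
  rw [curvature, leviCivita_leviCivita hr hxO hxM hP hPM hu hv hw,
    leviCivita_leviCivita hr hxO hxM hP hPM hv hu hw, leviCivita, hPM x hxM,
    hr.fderivWithin_eq hw.1 hxO hxM huv, VectorField.lieBracketWithin,
    hr.fderivWithin_eq hv.1 hxO hxM (hu.2 x hxM), hr.fderivWithin_eq hu.1 hxO hxM (hv.2 x hxM)]
  -- The second derivatives cancel by `hsymm`; the terms `dw(dv(u))` and `dw(du(v))` cancel against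
  -- the bracket term.
  simp only [map_add, map_sub, hPP, hsymm]
  abel

/-- A version of `curvature_eq` in which the projections are given as linear maps. -/
theorem curvature_eq_of_linearMap {M O : Set E} {r u v w : E → E} {x : E} {P : E → E →ₗ[ℝ] E}
    (hr : IsSmoothRetraction M O r) (hxO : x ∈ O) (hxM : x ∈ M)
    (hP : ∀ a, ContDiff ℝ ∞ fun y => P y a)
    (hPM : ∀ y ∈ M, ∀ a, (tangentSpace M y).starProjection a = P y a)
    (hu : IsSmoothVectorField M u) (hv : IsSmoothVectorField M v)
    (hw : IsSmoothVectorField M w)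
    (huv : VectorField.lieBracketWithin ℝ u v M x ∈ tangentSpace M x) :
    curvature M u v w x =
      P x (fderiv ℝ (fun y => P y (fderivWithin ℝ w M x (v x))) x (u x))
        - P x (fderiv ℝ (fun y => P y (fderivWithin ℝ w M x (u x))) x (v x)) := by
  have hP' : ContDiff ℝ ∞ fun y => LinearMap.toContinuousLinearMap (P y) :=
    contDiff_clm_apply_iff.mpr hP
  have hd : ∀ a b, fderiv ℝ (fun y => P y a) x b
      = fderiv ℝ (fun y => LinearMap.toContinuousLinearMap (P y)) x b a := fun a b => by
    have h := ((hP'.contDiffAt (x := x)).differentiableAt (by simp)).hasFDerivAt.clm_apply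
      (hasFDerivAt_const a x)
    simpa using congrArg (· b) h.fderiv
  rw [hd, hd]
  exact curvature_eq hr hxO hxM hP' (fun y hy => ContinuousLinearMap.ext (hPM y hy)) hu hv hw huv

end Retraction

end EmbeddedManifold

attribute [local instance] Matrix.frobeniusNormedRing Matrix.frobeniusNormedAlgebra
attribute [local instance] Matrix.frobeniusNormedAddCommGroup Matrix.frobeniusNormedSpace

namespace Involution

open EmbeddedManifold

/-! ### Tangent spaces of the Grassmannian and their orthogonal projections -/

section Tangent

variable {n : ℕ}

theorem hasDerivAt_transpose {γ : ℝ → Matrix (Fin n) (Fin n) ℝ} {v : Matrix (Fin n) (Fin n) ℝ}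
    {t : ℝ} (h : HasDerivAt γ v t) : HasDerivAt (fun s => (γ s)ᵀ) vᵀ t :=
  (LinearMap.toContinuousLinearMap
    (Matrix.transposeLinearEquiv (Fin n) (Fin n) ℝ ℝ).toLinearMap).hasFDerivAt.comp_hasDerivAt t h

theorem contDiff_transpose {F : Type*} [NormedAddCommGroup F] [NormedSpace ℝ F]
    {f : F → Matrix (Fin n) (Fin n) ℝ} (hf : ContDiff ℝ ∞ f) :
    ContDiff ℝ ∞ fun x => (f x)ᵀ :=
  (LinearMap.toContinuousLinearMap
    (Matrix.transposeLinearEquiv (Fin n) (Fin n) ℝ ℝ).toLinearMap).contDiff.comp hf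

/-- The conjugates `exp(tΩ) Q exp(-tΩ)` by rotations form a curve in the Grassmannian. -/
theorem exists_curve {k : ℕ} {Q X : Matrix (Fin n) (Fin n) ℝ} (hQ : Q ∈ Gr k n) (hX : Xᵀ = X)
    (hXQ : X * Q + Q * X = 0) :
    ∃ γ : ℝ → Matrix (Fin n) (Fin n) ℝ, ContDiff ℝ ∞ γ ∧ (∀ t, γ t ∈ Gr k n) ∧ γ 0 = Q ∧
      HasDerivAt γ X 0 := by
  obtain ⟨hQT, hQQ, hQtr⟩ := hQ
  -- Since `X` anticommutes with `Q` and `Q² = 1`, this `Ω` is skew and `ΩQ - QΩ = X`, which is the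
  -- required velocity.
  set Ω : Matrix (Fin n) (Fin n) ℝ := (1 / 2 : ℝ) • (X * Q) with hΩ
  have hQX : Q * X = -(X * Q) := eq_neg_of_add_eq_zero_right hXQ
  have hΩT : Ωᵀ = -Ω := by simp [hΩ, Matrix.transpose_mul, hQT, hX, hQX]
  have hexp : ContDiff ℝ ∞ (NormedSpace.exp : Matrix (Fin n) (Fin n) ℝ → _) := by
    have : AnalyticOnNhd ℝ (NormedSpace.exp : Matrix (Fin n) (Fin n) ℝ → _) Set.univ :=
      fun x _ => NormedSpace.exp_analytic x
    exact this.contDiff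
  have hsm : ∀ A : Matrix (Fin n) (Fin n) ℝ,
      ContDiff ℝ ∞ fun t : ℝ => NormedSpace.exp (t • A) := fun A =>
    hexp.comp (contDiff_id.smul contDiff_const)
  have hinv : ∀ t : ℝ, NormedSpace.exp (t • -Ω) * NormedSpace.exp (t • Ω) = 1 := fun t => by
    rw [← Matrix.exp_add_of_commute, ← smul_add, neg_add_cancel, smul_zero, NormedSpace.exp_zero]
    exact ((Commute.refl Ω).neg_left.smul_left t).smul_right t
  have hT : ∀ t : ℝ, (NormedSpace.exp (t • Ω))ᵀ = NormedSpace.exp (t • -Ω) := fun t => by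
    rw [← Matrix.exp_transpose, Matrix.transpose_smul, hΩT]
  have hT' : ∀ t : ℝ, (NormedSpace.exp (t • -Ω))ᵀ = NormedSpace.exp (t • Ω) := fun t => by
    rw [← hT, Matrix.transpose_transpose]
  refine ⟨fun t => NormedSpace.exp (t • Ω) * Q * NormedSpace.exp (t • -Ω),
    ((hsm Ω).mul contDiff_const).mul (hsm (-Ω)), fun t => ⟨?_, ?_, ?_⟩, ?_, ?_⟩
  · simp only [Matrix.transpose_mul, hT, hT', hQT, mul_assoc]
  · calc _ = NormedSpace.exp (t • Ω) * Q * (NormedSpace.exp (t • -Ω) * NormedSpace.exp (t • Ω))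
          * Q * NormedSpace.exp (t • -Ω) := by simp only [mul_assoc]
      _ = NormedSpace.exp (t • Ω) * (Q * Q) * NormedSpace.exp (t • -Ω) := by
          rw [hinv, mul_one, mul_assoc _ Q Q]
      _ = 1 := by rw [hQQ, mul_one]; exact mul_eq_one_comm.mp (hinv t)
  · rw [Matrix.trace_mul_comm, ← mul_assoc, hinv, one_mul, hQtr]
  · simp [NormedSpace.exp_zero]
  · have h1 := hasDerivAt_exp_smul_const (𝕂 := ℝ) Ω (0 : ℝ)
    have h2 := hasDerivAt_exp_smul_const (𝕂 := ℝ) (-Ω) (0 : ℝ)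
    refine ((h1.mul_const Q).mul h2).congr_deriv ?_
    simp only [zero_smul, NormedSpace.exp_zero, one_mul, mul_one, hΩ]
    rw [smul_mul_assoc, mul_assoc, hQQ, mul_neg, mul_smul_comm, ← mul_assoc Q, hQX, neg_mul,
      mul_assoc, hQQ]
    simp only [mul_one, smul_neg, neg_neg]
    rw [← add_smul]
    norm_num

/-- Differentiating `Qᵀ = Q` and `Q² = 1` along a curve gives the two linear equations; the
conjugation curves show that they suffice. The trace condition contributes no further equation. -/
theorem mem_tangentSpace_iff {k : ℕ} {Q X : Matrix (Fin n) (Fin n) ℝ} (hQ : Q ∈ Gr k n) :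
    X ∈ tangentSpace (Gr k n) Q ↔ Xᵀ = X ∧ X * Q + Q * X = 0 := by
  refine ⟨fun h => ?_, fun h => Submodule.subset_span (exists_curve hQ h.1 h.2)⟩
  induction h using Submodule.span_induction with
  | mem v hv =>
    obtain ⟨γ, -, hγM, rfl, hγ⟩ := hv
    constructor
    · exact (hasDerivAt_transpose hγ).unique (hγ.congr_of_eventuallyEq
        (.of_forall fun t => (hγM t).1))
    · exact (hγ.mul hγ).unique ((hasDerivAt_const (0 : ℝ) (1 : Matrix (Fin n) (Fin n) ℝ)
        ).congr_of_eventuallyEq (.of_forall fun t => (hγM t).2.1))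
  | zero => simp
  | add a b _ _ ha hb =>
    refine ⟨by rw [Matrix.transpose_add, ha.1, hb.1], ?_⟩
    rw [add_mul, mul_add, add_add_add_comm, ha.2, hb.2, add_zero]
  | smul c a _ ha =>
    refine ⟨by rw [Matrix.transpose_smul, ha.1], ?_⟩
    rw [smul_mul_assoc, mul_smul_comm, ← smul_add, ha.2, smul_zero]

/-- For `Q ∈ Gr(k, n)` the orthogonal projection to the tangent space at `Q`. -/
noncomputable def tangentProj (Q : Matrix (Fin n) (Fin n) ℝ) :
    Matrix (Fin n) (Fin n) ℝ →ₗ[ℝ] Matrix (Fin n) (Fin n) ℝ where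
  toFun A := (1 / 4 : ℝ) • ((A + Aᵀ) - Q * (A + Aᵀ) * Q)
  map_add' A B := by
    rw [Matrix.transpose_add, ← smul_add]
    congr 1
    noncomm_ring
  map_smul' c A := by
    simp only [Matrix.transpose_smul, RingHom.id_apply, ← smul_add, mul_smul_comm,
      smul_mul_assoc, ← smul_sub]
    rw [smul_comm]

theorem tangentProj_apply (Q A : Matrix (Fin n) (Fin n) ℝ) :
    tangentProj Q A = (1 / 4 : ℝ) • ((A + Aᵀ) - Q * (A + Aᵀ) * Q) := rfl

theorem contDiff_tangentProj (A : Matrix (Fin n) (Fin n) ℝ) :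
    ContDiff ℝ ∞ fun Q => tangentProj Q A := by
  simp only [tangentProj_apply]
  exact (contDiff_const.sub ((contDiff_id.mul contDiff_const).mul contDiff_id)).const_smul (1 / 4 : ℝ)

theorem fderiv_tangentProj (Q U A : Matrix (Fin n) (Fin n) ℝ) :
    fderiv ℝ (fun x => tangentProj x A) Q U =
      (1 / 4 : ℝ) • (-(U * (A + Aᵀ) * Q) - Q * (A + Aᵀ) * U) := by
  -- The directional derivative is computed along a line in the ambient matrix space.
  have hl : HasDerivAt (fun t : ℝ => Q + t • U) U 0 :=
    (((hasDerivAt_id (0 : ℝ)).smul_const U).const_add Q).congr_deriv (one_smul ℝ U)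
  have h1 : HasFDerivAt (fun x => tangentProj x A) (fderiv ℝ (fun x => tangentProj x A) Q)
      (Q + (0 : ℝ) • U) := by
    rw [zero_smul, add_zero]
    exact ((contDiff_tangentProj A).contDiffAt.differentiableAt (by simp)).hasFDerivAt
  refine (h1.comp_hasDerivAt (0 : ℝ) hl).unique ?_
  have h2 : HasDerivAt (fun t : ℝ => (A + Aᵀ) - (Q + t • U) * (A + Aᵀ) * (Q + t • U)) _ 0 :=
    ((hl.mul_const (A + Aᵀ)).mul hl).const_sub (A + Aᵀ)
  refine (h2.const_smul (1 / 4 : ℝ)).congr_deriv ?_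
  simp only [zero_smul, add_zero]
  congr 1
  abel

theorem tangentProj_mem {k : ℕ} {Q : Matrix (Fin n) (Fin n) ℝ} (hQ : Q ∈ Gr k n)
    (A : Matrix (Fin n) (Fin n) ℝ) : tangentProj Q A ∈ tangentSpace (Gr k n) Q := by
  rw [mem_tangentSpace_iff hQ, tangentProj_apply]
  constructor
  · simp only [Matrix.transpose_smul, Matrix.transpose_sub, Matrix.transpose_add,
      Matrix.transpose_mul, Matrix.transpose_transpose, hQ.1, mul_assoc, add_comm]
  · rw [smul_mul_assoc, mul_smul_comm, ← smul_add, sub_mul, mul_sub, mul_assoc _ Q Q, hQ.2.1,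
      ← mul_assoc Q (Q * _) Q, ← mul_assoc Q Q, hQ.2.1, one_mul, mul_one]
    simp

/-- The residual is orthogonal to every tangent `w`: symmetry of `w` gives `tr(Aᵀw) = tr(Aw)`, and
anticommutation gives `tr(QBQw) = -tr(Bw)`. The four equal contributions account for the factor `1 /
4`. -/
theorem starProjection_tangentSpace {k : ℕ} {Q : Matrix (Fin n) (Fin n) ℝ} (hQ : Q ∈ Gr k n)
    (A : Matrix (Fin n) (Fin n) ℝ) :
    (tangentSpace (Gr k n) Q).starProjection A = tangentProj Q A := by
  refine Submodule.eq_starProjection_of_mem_of_inner_eq_zero (tangentProj_mem hQ A) fun w hw => ?_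
  obtain ⟨hwT, hwQ⟩ := (mem_tangentSpace_iff hQ).mp hw
  change ((A - tangentProj Q A)ᵀ * w).trace = 0
  have h1 : (Aᵀ * w).trace = (A * w).trace := by
    rw [← Matrix.trace_transpose, Matrix.transpose_mul, Matrix.transpose_transpose, hwT,
      Matrix.trace_mul_comm]
  have h2 : ∀ B : Matrix (Fin n) (Fin n) ℝ, (Q * B * Q * w).trace = -(B * w).trace := fun B => by
    rw [mul_assoc, mul_assoc, Matrix.trace_mul_comm, mul_assoc,
      eq_neg_of_add_eq_zero_right hwQ, neg_mul, mul_assoc w, hQ.2.1, mul_one, mul_neg,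
      Matrix.trace_neg]
  rw [tangentProj_apply, Matrix.transpose_sub, sub_mul, Matrix.trace_sub, Matrix.transpose_smul,
    smul_mul_assoc, Matrix.trace_smul, Matrix.transpose_sub, sub_mul, Matrix.trace_sub,
    Matrix.transpose_mul, Matrix.transpose_mul, hQ.1, ← mul_assoc, h2]
  simp only [Matrix.transpose_add, Matrix.transpose_transpose, add_mul, Matrix.trace_add, h1,
    smul_eq_mul]
  ring

/-- Projecting the constant field `X` to each tangent space gives an extension. -/
theorem exists_vectorField {k : ℕ} {Q X : Matrix (Fin n) (Fin n) ℝ} (hQ : Q ∈ Gr k n)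
    (hX : X ∈ tangentSpace (Gr k n) Q) :
    ∃ A, IsSmoothVectorField (Gr k n) A ∧ A Q = X := by
  refine ⟨fun x => tangentProj x X, ⟨?_, fun x hx => tangentProj_mem hx X⟩, ?_⟩
  · exact (contDiff_tangentProj X).contDiffOn
  · change tangentProj Q X = X
    rw [← starProjection_tangentSpace hQ]
    exact Submodule.starProjection_eq_self_iff.mpr hX

end Tangent

/-! ### A smooth retraction of a neighbourhood onto the Grassmannian -/

section Retraction

variable {n : ℕ}

/-- An orthogonal projection to a subspace of the image of `E`, of the same rank, equals `E`. -/
theorem eq_of_trace_eq {E P : Matrix (Fin n) (Fin n) ℝ} (hET : Eᵀ = E) (hEE : E * E = E)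
    (hPT : Pᵀ = P) (hPP : P * P = P) (hEP : E * P = P) (htr : P.trace = E.trace) : P = E := by
  have hPE : P * E = P := by
    have := congrArg Matrix.transpose hEP
    rwa [Matrix.transpose_mul, hPT, hET] at this
  -- The product equals `E - P`, so the squared Frobenius norm of `P - E` is a difference of equal
  -- traces.
  have h : ((P - E)ᵀ * (P - E)).trace = 0 := by
    rw [Matrix.transpose_sub, hPT, hET, sub_mul, mul_sub, mul_sub, hPP, hPE, hEP, hEE]
    simp [htr]
  have h0 : (P - E)ᴴ * (P - E) = (P - E)ᵀ * (P - E) := by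
    rw [Matrix.conjTranspose_eq_transpose_of_trivial]
  rw [← h0, Matrix.trace_conjTranspose_mul_self_eq_zero_iff] at h
  exact sub_eq_zero.mp h

/-- The matrix `(FᵀF + 1 - E)` for `E = (1 + Q) / 2` and `F = (1 + A) / 2 * E`. -/
noncomputable def gram (Q A : Matrix (Fin n) (Fin n) ℝ) : Matrix (Fin n) (Fin n) ℝ :=
  ((1 / 2 : ℝ) • (1 + A) * ((1 / 2 : ℝ) • (1 + Q)))ᵀ
    * ((1 / 2 : ℝ) • (1 + A) * ((1 / 2 : ℝ) • (1 + Q))) + (1 - (1 / 2 : ℝ) • (1 + Q))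

/-- The reflection in the image under `(1 + A) / 2` of the `1`-eigenspace of `Q`. -/
noncomputable def retract (Q A : Matrix (Fin n) (Fin n) ℝ) : Matrix (Fin n) (Fin n) ℝ :=
  (2 : ℝ) • (((1 / 2 : ℝ) • (1 + A) * ((1 / 2 : ℝ) • (1 + Q))) * Ring.inverse (gram Q A)
    * ((1 / 2 : ℝ) • (1 + A) * ((1 / 2 : ℝ) • (1 + Q)))ᵀ) - 1

theorem half_one_add_spec {k : ℕ} {Q : Matrix (Fin n) (Fin n) ℝ} (hQ : Q ∈ Gr k n) :
    ((1 / 2 : ℝ) • (1 + Q))ᵀ = (1 / 2 : ℝ) • (1 + Q) ∧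
    ((1 / 2 : ℝ) • (1 + Q)) * ((1 / 2 : ℝ) • (1 + Q)) = (1 / 2 : ℝ) • (1 + Q) ∧
    ((1 / 2 : ℝ) • (1 + Q)).trace = k := by
  refine ⟨by simp [hQ.1], ?_, ?_⟩
  · rw [smul_mul_smul_comm, add_mul, mul_add Q, one_mul, mul_one, hQ.2.1]
    module
  · simp only [Matrix.trace_smul, Matrix.trace_add, Matrix.trace_one, Fintype.card_fin, hQ.2.2,
      smul_eq_mul]
    ring

/-- `F H Fᵀ` is the orthogonal projection onto the image of `F`. The summand `1 - E` fills the
kernel of `E`, on which `FᵀF` vanishes, so that the sum can be invertible. Everything follows from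
`FᵀF H = E`, obtained by multiplying the Gram matrix by `E`. -/
theorem projection_spec {E F H : Matrix (Fin n) (Fin n) ℝ} (hET : Eᵀ = E)
    (hEE : E * E = E) (hFE : F * E = F) (hH : IsUnit (Fᵀ * F + (1 - E)))
    (hH' : H = Ring.inverse (Fᵀ * F + (1 - E))) :
    (F * H * Fᵀ)ᵀ = F * H * Fᵀ ∧ (F * H * Fᵀ) * (F * H * Fᵀ) = F * H * Fᵀ ∧
      (F * H * Fᵀ).trace = E.trace := by
  have hEF : E * Fᵀ = Fᵀ := by
    have := congrArg Matrix.transpose hFE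
    rwa [Matrix.transpose_mul, hET] at this
  have hG : E * (Fᵀ * F + (1 - E)) = Fᵀ * F := by
    rw [mul_add, mul_sub, hEE, mul_one, sub_self, add_zero, ← mul_assoc, hEF]
  have hE : Fᵀ * F * H = E := by
    rw [← hG, hH', mul_assoc, Ring.mul_inverse_cancel _ hH, mul_one]
  have hHT : Hᵀ = H := by
    rw [hH', ← Matrix.nonsing_inv_eq_ringInverse, Matrix.transpose_nonsing_inv]
    simp [Matrix.transpose_mul, hET]
  refine ⟨by simp [Matrix.transpose_mul, hHT, mul_assoc], ?_, ?_⟩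
  · calc _ = F * H * (Fᵀ * F * H) * Fᵀ := by simp only [mul_assoc]
      _ = F * H * Fᵀ := by rw [hE, mul_assoc _ E, hEF]
  · rw [Matrix.trace_mul_comm, ← mul_assoc, hE]

theorem retract_mem {k : ℕ} {Q A : Matrix (Fin n) (Fin n) ℝ} (hQ : Q ∈ Gr k n)
    (hA : IsUnit (gram Q A)) : retract Q A ∈ Gr k n := by
  obtain ⟨hET, hEE, hEtr⟩ := half_one_add_spec hQ
  obtain ⟨h1, h2, h3⟩ := projection_spec hET hEE (F := (1 / 2 : ℝ) • (1 + A) * ((1 / 2 : ℝ) • (1 + Q)))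
    (by rw [mul_assoc, hEE]) hA rfl
  rw [hEtr] at h3
  refine ⟨?_, ?_, ?_⟩
  · rw [retract, gram, Matrix.transpose_sub, Matrix.transpose_smul, h1, Matrix.transpose_one]
  · rw [retract, gram, sub_mul, mul_sub, smul_mul_smul_comm, h2, mul_one, one_mul]
    module
  · rw [retract, gram, Matrix.trace_sub, Matrix.trace_smul, h3]
    simp

/-- For `A` in the Grassmannian, `(1 + A) / 2` is itself a projection of trace `k`. The projection
built from `F` has image inside its image and the same trace, so the two coincide. -/
theorem retract_eq_self {k : ℕ} {Q A : Matrix (Fin n) (Fin n) ℝ} (hQ : Q ∈ Gr k n)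
    (hA : IsUnit (gram Q A)) (hAM : A ∈ Gr k n) : retract Q A = A := by
  obtain ⟨hET, hEE, hEtr⟩ := half_one_add_spec hQ
  obtain ⟨hPT, hPP, hPtr⟩ := half_one_add_spec hAM
  obtain ⟨h1, h2, h3⟩ := projection_spec hET hEE (F := (1 / 2 : ℝ) • (1 + A) * ((1 / 2 : ℝ) • (1 + Q)))
    (by rw [mul_assoc, hEE]) hA rfl
  rw [retract, gram, eq_of_trace_eq hPT hPP h1 h2 ?_ (by rw [h3, hEtr, hPtr])]
  · module
  · simp only [← mul_assoc, hPP]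

theorem isSmoothRetraction_retract {k : ℕ} {Q : Matrix (Fin n) (Fin n) ℝ} (hQ : Q ∈ Gr k n) :
    IsSmoothRetraction (Gr k n) {A | IsUnit (gram Q A)} (retract Q) := by
  have hF : ContDiff ℝ ∞ fun A : Matrix (Fin n) (Fin n) ℝ =>
      (1 / 2 : ℝ) • (1 + A) * ((1 / 2 : ℝ) • (1 + Q)) :=
    ((contDiff_const.add contDiff_id).const_smul (1 / 2 : ℝ)).mul contDiff_const
  have hG : ContDiff ℝ ∞ (gram Q) := ((contDiff_transpose hF).mul hF).add contDiff_const
  refine ⟨Units.isOpen.preimage hG.continuous, fun A hA => ContDiffAt.contDiffWithinAt ?_,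
    fun A hA => retract_mem hQ hA, fun A hA hAM => retract_eq_self hQ hA hAM⟩
  obtain ⟨a, ha⟩ := hA
  have hinv : ContDiffAt ℝ ∞ (fun A => Ring.inverse (gram Q A)) A := by
    refine ContDiffAt.comp A (g := Ring.inverse) ?_ hG.contDiffAt
    rw [← ha]
    exact contDiffAt_ringInverse ℝ a
  exact (((hF.contDiffAt.mul hinv).mul (contDiff_transpose hF).contDiffAt).const_smul
    (2 : ℝ)).sub contDiffAt_const

theorem isUnit_gram_self {k : ℕ} {Q : Matrix (Fin n) (Fin n) ℝ} (hQ : Q ∈ Gr k n) :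
    IsUnit (gram Q Q) := by
  obtain ⟨hET, hEE, -⟩ := half_one_add_spec hQ
  rw [gram, hEE, hET, hEE, add_sub_cancel]
  exact isUnit_one

end Retraction

/-! ### The curvature as a double commutator -/

section Curvature

variable {k n : ℕ}

/-- Derivatives of vector fields satisfy the differentiated equations of the tangent spaces. -/
theorem fderivWithin_vectorField {Q v : Matrix (Fin n) (Fin n) ℝ}
    {w : Matrix (Fin n) (Fin n) ℝ → Matrix (Fin n) (Fin n) ℝ} (hQ : Q ∈ Gr k n)
    (hw : IsSmoothVectorField (Gr k n) w) (hv : v ∈ tangentSpace (Gr k n) Q) :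
    (fderivWithin ℝ w (Gr k n) Q v)ᵀ = fderivWithin ℝ w (Gr k n) Q v ∧
    fderivWithin ℝ w (Gr k n) Q v * Q + Q * fderivWithin ℝ w (Gr k n) Q v
      = -(w Q * v + v * w Q) := by
  obtain ⟨hvT, hvQ⟩ := (mem_tangentSpace_iff hQ).mp hv
  obtain ⟨γ, -, hγM, rfl, hγ⟩ := exists_curve hQ hvT hvQ
  have hd : HasDerivAt (w ∘ γ) (fderivWithin ℝ w (Gr k n) (γ 0) v) 0 :=
    ((hw.1 _ hQ).differentiableWithinAt (by simp)).hasFDerivWithinAt.comp_hasDerivAt (0 : ℝ) hγ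
      (.of_forall hγM)
  have hT := fun t => (mem_tangentSpace_iff (hγM t)).mp (hw.2 _ (hγM t))
  constructor
  · exact (hasDerivAt_transpose hd).unique (hd.congr_of_eventuallyEq (.of_forall fun t => (hT t).1))
  · have h := ((hd.mul hγ).add (hγ.mul hd)).unique
      ((hasDerivAt_const (0 : ℝ) (0 : Matrix (Fin n) (Fin n) ℝ)).congr_of_eventuallyEq
        (.of_forall fun t => (hT t).2))
    rw [← sub_eq_zero, ← h]
    simp only [Function.comp_apply]
    abel

/-- The defect `-(uv + vu)` in the differentiated anticommutation relation is symmetric in the two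
fields, so it cancels in the bracket. -/
theorem lieBracketWithin_mem {Q : Matrix (Fin n) (Fin n) ℝ}
    {u v : Matrix (Fin n) (Fin n) ℝ → Matrix (Fin n) (Fin n) ℝ} (hQ : Q ∈ Gr k n)
    (hu : IsSmoothVectorField (Gr k n) u) (hv : IsSmoothVectorField (Gr k n) v) :
    VectorField.lieBracketWithin ℝ u v (Gr k n) Q ∈ tangentSpace (Gr k n) Q := by
  obtain ⟨h1, h2⟩ := fderivWithin_vectorField hQ hv (hu.2 Q hQ)
  obtain ⟨h3, h4⟩ := fderivWithin_vectorField hQ hu (hv.2 Q hQ)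
  rw [mem_tangentSpace_iff hQ, VectorField.lieBracketWithin]
  refine ⟨ (Matrix.transpose_sub _ _).trans (congrArg₂ _ h1 h3), ?_⟩
  rw [sub_mul, mul_sub, sub_add_sub_comm]
  erw [h2, h4]
  abel

/-- The derivative of the projection is `-(USQ + QSU) / 2`. Projecting it and moving `Q` past `U`
leaves `-(UN + NU) / 4` with `N = SQ + QS`, which no longer involves `S` separately. -/
theorem tangentProj_fderiv_tangentProj {Q U V W S : Matrix (Fin n) (Fin n) ℝ} (hQ : Q ∈ Gr k n)
    (hU : U ∈ tangentSpace (Gr k n) Q) (hS : Sᵀ = S) (hSQ : S * Q + Q * S = -(W * V + V * W)) :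
    tangentProj Q (fderiv ℝ (fun x => tangentProj x S) Q U)
      = (1 / 4 : ℝ) • (U * (W * V + V * W) + (W * V + V * W) * U) := by
  obtain ⟨hUT, hUQ⟩ := (mem_tangentSpace_iff hQ).mp hU
  have hQU : Q * U = -(U * Q) := eq_neg_of_add_eq_zero_right hUQ
  have hQQ := hQ.2.1
  have hN : W * V + V * W = -(S * Q + Q * S) := by rw [hSQ, neg_neg]
  have hQQ' : ∀ B, Q * (Q * B) = B := fun B => by rw [← mul_assoc, hQQ, one_mul]
  have hQU' : ∀ B, Q * (U * B) = -(U * (Q * B)) := fun B => by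
    rw [← mul_assoc, hQU, neg_mul, mul_assoc]
  rw [hN, fderiv_tangentProj, tangentProj_apply, hS]
  simp only [Matrix.transpose_smul, Matrix.transpose_sub, Matrix.transpose_neg,
    Matrix.transpose_mul, hS, hUT, hQ.1, ← two_smul ℝ S,
    smul_mul_assoc, mul_smul_comm, mul_sub, sub_mul, mul_add, add_mul, mul_neg, neg_mul,
    mul_assoc, hQQ, hQQ', hQU, hQU', mul_one, ← smul_add, ← smul_sub, ← smul_neg, smul_smul]
  module

theorem curvature_eq_commutator {Q : Matrix (Fin n) (Fin n) ℝ}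
    {u v w : Matrix (Fin n) (Fin n) ℝ → Matrix (Fin n) (Fin n) ℝ} (hQ : Q ∈ Gr k n)
    (hu : IsSmoothVectorField (Gr k n) u) (hv : IsSmoothVectorField (Gr k n) v)
    (hw : IsSmoothVectorField (Gr k n) w) :
    curvature (Gr k n) u v w Q = (1 / 4 : ℝ) • ((u Q * v Q - v Q * u Q) * w Q
      - w Q * (u Q * v Q - v Q * u Q)) := by
  obtain ⟨h1, h2⟩ := fderivWithin_vectorField hQ hw (hv.2 Q hQ)
  obtain ⟨h3, h4⟩ := fderivWithin_vectorField hQ hw (hu.2 Q hQ)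
  refine (curvature_eq_of_linearMap (isSmoothRetraction_retract hQ) (isUnit_gram_self hQ) hQ
    contDiff_tangentProj (fun y hy => starProjection_tangentSpace hy) hu hv hw
    (lieBracketWithin_mem hQ hu hv)).trans ?_
  refine (congrArg₂ (· - ·) (tangentProj_fderiv_tangentProj hQ (hu.2 Q hQ) h1 h2)
    (tangentProj_fderiv_tangentProj hQ (hv.2 Q hQ) h3 h4)).trans ?_
  simp only [← smul_sub]
  congr 1
  noncomm_ring

theorem hasRiemannCurvature {Q X Y Z W : Matrix (Fin n) (Fin n) ℝ} (hQ : Q ∈ Gr k n)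
    (hX : X ∈ tangentSpace (Gr k n) Q) (hY : Y ∈ tangentSpace (Gr k n) Q)
    (hZ : Z ∈ tangentSpace (Gr k n) Q) (hW : W ∈ tangentSpace (Gr k n) Q) :
    HasRiemannCurvature (Gr k n) Q X Y Z W (1 / 2 * ((X * Y - Y * X) * Z * W).trace) := by
  refine ⟨hQ, hW, ?_, ?_⟩
  · rintro a (rfl | rfl | rfl)
    exacts [exists_vectorField hQ hX, exists_vectorField hQ hY, exists_vectorField hQ hZ]
  · rintro u v w hu hv hw rfl rfl rfl
    have hX' := ((mem_tangentSpace_iff hQ).mp hX).1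
    have hY' := ((mem_tangentSpace_iff hQ).mp hY).1
    have hZ' := ((mem_tangentSpace_iff hQ).mp hZ).1
    have hW' := ((mem_tangentSpace_iff hQ).mp hW).1
    change ((curvature (Gr k n) u v w Q)ᵀ * W).trace = _
    rw [curvature_eq_commutator hQ hu hv hw]
    have hC : (u Q * v Q - v Q * u Q)ᵀ = -(u Q * v Q - v Q * u Q) := by
      rw [Matrix.transpose_sub, Matrix.transpose_mul, Matrix.transpose_mul, hX', hY', neg_sub]
    generalize u Q * v Q - v Q * u Q = C at hC
    generalize w Q = Z at hZ'
    -- Transposition and cyclicity, with `C` skew, make both halves of the outer commutator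
    -- contribute equally, turning `1 / 4` into `1 / 2`.
    have h : (Z * C * W).trace = -(C * Z * W).trace := by
      rw [← Matrix.trace_transpose, Matrix.transpose_mul, Matrix.transpose_mul, hZ', hW', hC,
        Matrix.trace_mul_comm]
      simp
    simp only [Matrix.transpose_smul, Matrix.transpose_sub, Matrix.transpose_mul, hC, hZ',
      smul_mul_assoc, Matrix.trace_smul, Matrix.trace_sub, sub_mul, mul_neg, neg_mul,
      Matrix.trace_neg, smul_eq_mul, h]
    ring

end Curvature

/-! ### The formula in block coordinates -/

section Blocks

variable {k n : ℕ} (hkn : k ≤ n)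

theorem blocks_mul (A A' : Matrix (Fin k) (Fin k) ℝ) (B B' : Matrix (Fin k) (Fin (n - k)) ℝ)
    (C C' : Matrix (Fin (n - k)) (Fin k) ℝ) (D D' : Matrix (Fin (n - k)) (Fin (n - k)) ℝ) :
    blocks hkn A B C D * blocks hkn A' B' C' D' =
      blocks hkn (A * A' + B * C') (A * B' + B * D') (C * A' + D * C') (C * B' + D * D') := by
  simp only [blocks, Matrix.reindex_apply, Matrix.submatrix_mul_equiv, Matrix.fromBlocks_multiply]

theorem blocks_transpose (A : Matrix (Fin k) (Fin k) ℝ) (B : Matrix (Fin k) (Fin (n - k)) ℝ)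
    (C : Matrix (Fin (n - k)) (Fin k) ℝ) (D : Matrix (Fin (n - k)) (Fin (n - k)) ℝ) :
    (blocks hkn A B C D)ᵀ = blocks hkn Aᵀ Cᵀ Bᵀ Dᵀ := by
  simp only [blocks, Matrix.transpose_reindex, Matrix.fromBlocks_transpose]

theorem blocks_add (A A' : Matrix (Fin k) (Fin k) ℝ) (B B' : Matrix (Fin k) (Fin (n - k)) ℝ)
    (C C' : Matrix (Fin (n - k)) (Fin k) ℝ) (D D' : Matrix (Fin (n - k)) (Fin (n - k)) ℝ) :
    blocks hkn A B C D + blocks hkn A' B' C' D' =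
      blocks hkn (A + A') (B + B') (C + C') (D + D') := by
  simp only [blocks, Matrix.reindex_apply, ← Matrix.fromBlocks_add, Matrix.submatrix_add,
    Pi.add_apply]

theorem blocks_sub (A A' : Matrix (Fin k) (Fin k) ℝ) (B B' : Matrix (Fin k) (Fin (n - k)) ℝ)
    (C C' : Matrix (Fin (n - k)) (Fin k) ℝ) (D D' : Matrix (Fin (n - k)) (Fin (n - k)) ℝ) :
    blocks hkn A B C D - blocks hkn A' B' C' D' =
      blocks hkn (A - A') (B - B') (C - C') (D - D') := by
  rw [sub_eq_iff_eq_add, blocks_add]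
  simp

theorem blocks_zero : blocks hkn 0 0 0 0 = 0 := by
  simp [blocks]

theorem trace_blocks (A : Matrix (Fin k) (Fin k) ℝ) (B : Matrix (Fin k) (Fin (n - k)) ℝ)
    (C : Matrix (Fin (n - k)) (Fin k) ℝ) (D : Matrix (Fin (n - k)) (Fin (n - k)) ℝ) :
    (blocks hkn A B C D).trace = A.trace + D.trace := by
  rw [blocks, Matrix.reindex_apply]
  refine (Equiv.sum_comp _ fun i => Matrix.fromBlocks A B C D i i).trans ?_
  simp [Matrix.trace]

theorem conj_mul_conj {V : Matrix (Fin n) (Fin n) ℝ} (hV : Vᵀ * V = 1)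
    (A B : Matrix (Fin n) (Fin n) ℝ) : V * A * Vᵀ * (V * B * Vᵀ) = V * (A * B) * Vᵀ := by
  calc _ = V * A * (Vᵀ * V) * B * Vᵀ := by simp only [mul_assoc]
    _ = _ := by rw [hV, mul_one, mul_assoc V A B]

theorem tangentMatrix_mem {V Q : Matrix (Fin n) (Fin n) ℝ} (hQ : Q ∈ Gr k n) (hV : Vᵀ * V = 1)
    (hQV : Q = V * blocks hkn 1 0 0 (-1) * Vᵀ) (X₀ : Matrix (Fin k) (Fin (n - k)) ℝ) :
    tangentMatrix hkn V X₀ ∈ tangentSpace (Gr k n) Q := by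
  rw [mem_tangentSpace_iff hQ, tangentMatrix]
  constructor
  · simp [Matrix.transpose_mul, blocks_transpose, mul_assoc]
  · rw [hQV, conj_mul_conj hV, conj_mul_conj hV, ← add_mul, ← mul_add, blocks_mul, blocks_mul,
      blocks_add]
    simp [blocks_zero]

theorem trace_tangentMatrix {V : Matrix (Fin n) (Fin n) ℝ} (hV : Vᵀ * V = 1)
    (X₀ Y₀ Z₀ W₀ : Matrix (Fin k) (Fin (n - k)) ℝ) :
    ((tangentMatrix hkn V X₀ * tangentMatrix hkn V Y₀
        - tangentMatrix hkn V Y₀ * tangentMatrix hkn V X₀) * tangentMatrix hkn V Z₀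
        * tangentMatrix hkn V W₀).trace =
      ((X₀ᵀ * Y₀ * Z₀ᵀ + Z₀ᵀ * Y₀ * X₀ᵀ - Y₀ᵀ * X₀ * Z₀ᵀ - Z₀ᵀ * X₀ * Y₀ᵀ) * W₀).trace := by
  simp only [tangentMatrix]
  rw [conj_mul_conj hV, conj_mul_conj hV, ← sub_mul, ← mul_sub, conj_mul_conj hV, conj_mul_conj hV,
    Matrix.trace_mul_comm, ← mul_assoc, hV, one_mul]
  simp only [blocks_mul, blocks_sub, trace_blocks, Matrix.zero_mul, Matrix.mul_zero, zero_add,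
    add_zero, sub_zero]
  -- The upper left block contributes traces of `k × k` products; transposing and cycling brings
  -- them to the form `tr(⋯ W₀)` of the lower right block.
  have h : ∀ A B : Matrix (Fin k) (Fin (n - k)) ℝ,
      (A * Bᵀ * Z₀ * W₀ᵀ).trace = (Z₀ᵀ * B * Aᵀ * W₀).trace := fun A B => by
    rw [← Matrix.trace_transpose, Matrix.trace_mul_comm]
    simp only [Matrix.transpose_mul, Matrix.transpose_transpose, Matrix.mul_assoc]
  simp only [Matrix.sub_mul, Matrix.add_mul, Matrix.trace_sub, Matrix.trace_add, h]
  ring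

end Blocks

end Involution

theorem mainTheorem2 (k n : ℕ) (hkn : k ≤ n) (Q : Matrix (Fin n) (Fin n) ℝ)
    (hQ : Q ∈ Involution.Gr k n) :
    (∀ X Y Z W : Matrix (Fin n) (Fin n) ℝ,
      X ∈ EmbeddedManifold.tangentSpace (Involution.Gr k n) Q →
      Y ∈ EmbeddedManifold.tangentSpace (Involution.Gr k n) Q →
      Z ∈ EmbeddedManifold.tangentSpace (Involution.Gr k n) Q →
      W ∈ EmbeddedManifold.tangentSpace (Involution.Gr k n) Q →
      EmbeddedManifold.HasRiemannCurvature (Involution.Gr k n) Q X Y Z W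
        (1 / 2 * ((X * Y - Y * X) * Z * W).trace)) ∧
    (∀ V ∈ Matrix.orthogonalGroup (Fin n) ℝ,
      Q = V * Involution.blocks hkn 1 0 0 (-1) * Vᵀ →
      ∀ X₀ Y₀ Z₀ W₀ : Matrix (Fin k) (Fin (n - k)) ℝ,
        EmbeddedManifold.HasRiemannCurvature (Involution.Gr k n) Q
          (Involution.tangentMatrix hkn V X₀) (Involution.tangentMatrix hkn V Y₀)
          (Involution.tangentMatrix hkn V Z₀) (Involution.tangentMatrix hkn V W₀)
          (1 / 2 * ((X₀ᵀ * Y₀ * Z₀ᵀ + Z₀ᵀ * Y₀ * X₀ᵀ - Y₀ᵀ * X₀ * Z₀ᵀ - Z₀ᵀ * X₀ * Y₀ᵀ)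
            * W₀).trace)) := by
  refine ⟨fun X Y Z W hX hY hZ hW => Involution.hasRiemannCurvature hQ hX hY hZ hW,
    fun V hV hQV X₀ Y₀ Z₀ W₀ => ?_⟩
  have hV' : Vᵀ * V = 1 := (Matrix.mem_orthogonalGroup_iff' (Fin n) ℝ).mp hV
  have hmem := Involution.tangentMatrix_mem hkn hQ hV' hQV
  rw [← Involution.trace_tangentMatrix hkn hV' X₀ Y₀ Z₀ W₀]
  exact Involution.hasRiemannCurvature hQ (hmem X₀) (hmem Y₀) (hmem Z₀) (hmem W₀)
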